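/- **Theorem (Half-degree principle).** For $x\in\mathbb{R}^n$ let $\pi(x)=|\{x_1,\dots,x_n\}|$ be the number of distinct coordinates of $x$ and $\pi^+(x)=|\{x_1,\dots,x_n\}\cap\mathbb{R}_{>0}|$ the number of distinct positive coordinates of $x$. For $k\in\mathbb{N}$ put $A_k=\{x\in\mathbb{R}^n : \pi(x)\le k\}$ and $A_k^+=\{x\in\mathbb{R}_{\ge 0}^n : \pi^+(x)\le k\}$. Let $f\in\mathbb{R}[X_1,\dots,X_n]$ be a symmetric polynomial of (total) degree $d$ (the zero polynomial being given degree $0$). Then: 1. For $k=\max\{2,\lfloor d/2\rfloor\}$ the set $A_k$ is non-empty, and $f(y)\ge 0$ for all $y\in\mathbb{R}^n$ if and only if $f(\tilde y)\ge 0$ for all $\tilde y\in A_k$. 2. For $k=\max\{1,\lfloor d/2\rfloor\}$ the set $A_k^+$ is non-empty, and $f(y)\ge 0$ for all $y\in\mathbb{R}_{\ge 0}^n$ if and only if $f(\tilde y)\ge 0$ for all $\tilde y\in A_k^+$. 3. For $k=\max\{2,d\}$ and $V=\{y\in\mathbb{R}^n : f(y)=0\}$, we have $V\ne\emptyset$ if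 and only if $V\cap A_k\ne\emptyset$. -/

import Mathlib

namespace HalfDegree

/-- The number `π(x)` of distinct coordinates of `x ∈ ℝⁿ`. -/
noncomputable def numDistinct {n : ℕ} (x : Fin n → ℝ) : ℕ :=
  (Set.range x).ncard

/-- The number `π⁺(x)` of distinct positive coordinates of `x ∈ ℝⁿ`. -/
noncomputable def numDistinctPos {n : ℕ} (x : Fin n → ℝ) : ℕ :=
  (Set.range x ∩ Set.Ioi 0).ncard

/-- `A_k`: the points of `ℝⁿ` with at most `k` distinct coordinates. -/
def A (n k : ℕ) : Set (Fin n → ℝ) :=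
  {x | numDistinct x ≤ k}

/-- `A_k⁺`: the points of the closed non-negative orthant with at most `k` distinct positive
coordinates. -/
def APos (n k : ℕ) : Set (Fin n → ℝ) :=
  {x | (∀ i, 0 ≤ x i) ∧ numDistinctPos x ≤ k}

/-- The real zero set of a polynomial. -/
def zeroSet {n : ℕ} (f : MvPolynomial (Fin n) ℝ) : Set (Fin n → ℝ) :=
  {y | MvPolynomial.eval y f = 0}

end HalfDegree

/-!
The half-degree principle, by a perturbation of roots inside a fibre of the first elementary
symmetric polynomials `e_1, …, e_k`.

Write the symmetric polynomial as `f = g(e_1, …, e_n)`. Giving `e_i` the weight `i`, no monomial of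
`g` exceeds the degree of `f` (`weight_le_of_mem_support`). So if `deg f < 2(k + 1)`, then no
monomial of `g` contains two of the variables with index greater than `k`: once `e_1, …, e_k` are
fixed, `f` is an affine function of `e_{k+1}, …, e_n` (`eval_add_eval_of_isSymmetric`).

Fix a point `y` and consider the points with the same `e_1, …, e_k` as `y`, on all of `ℝⁿ` or on
the non-negative orthant. This fibre is compact, because `e_1` and `e_2` determine `∑ x_i²`,
respectively because `e_1 = ∑ x_i`. Among the minimisers of `f` on the fibre take one, `x`, with
minimal `e_{k+1}`. If `x` had more than `k` distinct (positive) coordinates, say `m`, then the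
polynomial `∏ (X - x_i)` would factor as `Q * R` with `Q` having exactly these `m` values as simple
roots. Simple real roots persist under small perturbations
(`eventually_prod_X_sub_C_add_eq_prod`), so `(Q ± ε X^(m-k-1)) * R` still has only real (and, in
the orthant, non-negative) roots. The added term has degree `n - k - 1`, so that it leaves
`e_1, …, e_k` alone and moves `e_{k+1}` strictly in opposite directions for the two signs
(`exists_esymm_segment`). As `f` is affine along this segment and minimal in its middle, it takes
the same value at both ends, one of which has a smaller `e_{k+1}`: a contradiction
(`exists_eval_le_ncard_le`).

The statement on zeros is the same minimisation applied to `f²`, whose degree is at most `2 deg f`.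
-/

namespace HalfDegree

/-! ### Symmetric polynomials in terms of the elementary ones -/

open MvPolynomial in
/-- Substituting the elementary symmetric polynomials turns the weighted grading into the grading by
total degree. As the substitution is injective, no cancellation can lower the degree. -/
lemma weight_le_of_mem_support {n : ℕ} (g : MvPolynomial (Fin n) ℝ) {t : Fin n →₀ ℕ}
    (ht : t ∈ g.support) :
    Finsupp.weight (fun i : Fin n ↦ (i : ℕ) + 1) t ≤
      (aeval (fun i : Fin n ↦ esymm (Fin n) ℝ (i + 1)) g).totalDegree := by
  set w : Fin n → ℕ := fun i ↦ (i : ℕ) + 1 with hw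
  set φ := aeval (R := ℝ) (fun i : Fin n ↦ esymm (Fin n) ℝ (i + 1)) with hφ
  have hesymm (j : ℕ) : (esymm (Fin n) ℝ j).IsHomogeneous j := by
    rw [esymm]
    refine IsHomogeneous.sum _ _ _ fun s hs ↦ ?_
    have := IsHomogeneous.prod s (fun i : Fin n ↦ (X i : MvPolynomial (Fin n) ℝ)) (fun _ ↦ 1)
      fun i _ ↦ isHomogeneous_X ℝ i
    simpa [(Finset.mem_powersetCard.mp hs).2] using this
  have hmono (s : Fin n →₀ ℕ) (r : ℝ) :
      (φ (monomial s r)).IsHomogeneous (Finsupp.weight w s) := by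
    rw [hφ, aeval_monomial, Finsupp.weight_apply]
    have := (isHomogeneous_C (Fin n) r).mul (IsHomogeneous.prod s.support
      (fun i : Fin n ↦ esymm (Fin n) ℝ (i + 1) ^ s i) (fun i ↦ s i * w i)
      fun i _ ↦ by simpa [hw, mul_comm] using (hesymm (i + 1)).pow (s i))
    simpa [Finsupp.prod, Finsupp.sum] using this
  have hcomp (m : ℕ) (p : MvPolynomial (Fin n) ℝ) :
      homogeneousComponent m (φ p) = φ (weightedHomogeneousComponent w m p) := by
    induction p using MvPolynomial.induction_on' with
    | monomial s r =>
      rw [homogeneousComponent_of_mem (hmono s r),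
        weightedHomogeneousComponent_of_mem (isWeightedHomogeneous_monomial w s r rfl)]
      split_ifs <;> simp
    | add p q hp hq => simp only [map_add, hp, hq]
  by_contra! hlt
  have h0 := homogeneousComponent_eq_zero _ _ hlt
  rw [hcomp] at h0
  have hinj : Function.Injective φ := by
    intro p q hpq
    refine esymmAlgHom_injective (σ := Fin n) (R := ℝ) (n := n) (by simp) (Subtype.ext ?_)
    rw [esymmAlgHom_apply, esymmAlgHom_apply]
    exact hpq
  have h1 := hinj (h0.trans (map_zero φ).symm)
  have := coeff_weightedHomogeneousComponent (w := w) (Finsupp.weight w t) g t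
  rw [h1, if_pos rfl, coeff_zero] at this
  exact mem_support_iff.mp ht this.symm

open MvPolynomial in
/-- A polynomial of weighted degree less than `2 (k + 1)` is affine in the variables of weight
greater than `k`; this is expressed through the midpoint of a segment in their directions.
The variable with index `i : Fin n` has weight `i + 1`. -/
lemma eval_add_add_eval_sub {n k : ℕ} (g : MvPolynomial (Fin n) ℝ)
    (hg : ∀ t ∈ g.support, Finsupp.weight (fun i : Fin n ↦ (i : ℕ) + 1) t < 2 * (k + 1))
    (c v : Fin n → ℝ) (hv : ∀ i : Fin n, (i : ℕ) < k → v i = 0) :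
    eval (c + v) g + eval (c - v) g = 2 * eval c g := by
  simp only [eval_eq, Finset.mul_sum, ← Finset.sum_add_distrib]
  refine Finset.sum_congr rfl fun t ht ↦ ?_
  have hwt := hg t ht
  rw [Finsupp.weight_apply, Finsupp.sum_fintype _ _ (by simp)] at hwt
  simp only [smul_eq_mul] at hwt
  by_cases h : ∃ i₀ : Fin n, k ≤ (i₀ : ℕ) ∧ t i₀ ≠ 0
  · -- The weight bound forces `t` to be linear in `X i₀` and free of all other high variables.
    obtain ⟨i₀, hi₀, ht₀⟩ := h
    have hsingle := Finset.single_le_sum (f := fun i : Fin n ↦ t i * ((i : ℕ) + 1))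
      (fun _ _ ↦ Nat.zero_le _) (Finset.mem_univ i₀)
    have h1 : t i₀ = 1 := by
      have : t i₀ < 2 := by
        by_contra! h2
        have := Nat.mul_le_mul h2 (Nat.succ_le_succ hi₀)
        simp only [Nat.succ_eq_add_one] at this
        omega
      omega
    have hrest : ∀ i ∈ t.support.erase i₀, v i = 0 := by
      intro i hi
      obtain ⟨hne, hi⟩ := Finset.mem_erase.mp hi
      refine hv i ?_
      by_contra! hki
      have hpair := Finset.sum_le_univ_sum_of_nonneg (s := {i, i₀})
        (f := fun i : Fin n ↦ t i * ((i : ℕ) + 1)) (fun _ ↦ Nat.zero_le _)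
      rw [Finset.sum_pair hne, h1] at hpair
      have : 1 * (k + 1) ≤ t i * ((i : ℕ) + 1) :=
        Nat.mul_le_mul (Nat.one_le_iff_ne_zero.mpr (Finsupp.mem_support_iff.mp hi)) (by omega)
      omega
    have hmem : i₀ ∈ t.support := Finsupp.mem_support_iff.mpr ht₀
    have hadd : ∏ i ∈ t.support.erase i₀, (c + v) i ^ t i = ∏ i ∈ t.support.erase i₀, c i ^ t i :=
      Finset.prod_congr rfl fun i hi ↦ by simp [hrest i hi]
    have hsub : ∏ i ∈ t.support.erase i₀, (c - v) i ^ t i = ∏ i ∈ t.support.erase i₀, c i ^ t i :=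
      Finset.prod_congr rfl fun i hi ↦ by simp [hrest i hi]
    rw [← Finset.mul_prod_erase _ _ hmem, ← Finset.mul_prod_erase _ _ hmem,
      ← Finset.mul_prod_erase _ _ hmem, hadd, hsub, h1]
    simp only [Pi.add_apply, Pi.sub_apply, pow_one]
    ring
  · push Not at h
    have hz : ∀ i ∈ t.support, v i = 0 := fun i hi ↦ hv i <| by
      by_contra! hki
      exact Finsupp.mem_support_iff.mp hi (h i hki)
    rw [Finset.prod_congr rfl fun i hi ↦ show (c + v) i ^ t i = c i ^ t i by simp [hz i hi],
      Finset.prod_congr rfl fun i hi ↦ show (c - v) i ^ t i = c i ^ t i by simp [hz i hi]]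
    ring

open MvPolynomial in
/-- On a fibre of `e_1, …, e_k`, a symmetric polynomial of degree less than `2 (k + 1)` is affine in
the values of the elementary symmetric polynomials. -/
lemma eval_add_eval_of_isSymmetric {n k : ℕ} {f : MvPolynomial (Fin n) ℝ} (hf : f.IsSymmetric)
    (hk : f.totalDegree < 2 * (k + 1)) {x y z : Fin n → ℝ}
    (hlow : ∀ j ≤ k, eval y (esymm (Fin n) ℝ j) = eval x (esymm (Fin n) ℝ j))
    (hmid : ∀ j ≤ n, eval y (esymm (Fin n) ℝ j) + eval z (esymm (Fin n) ℝ j) =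
      2 * eval x (esymm (Fin n) ℝ j)) :
    eval y f + eval z f = 2 * eval x f := by
  obtain ⟨g, hg⟩ := esymmAlgHom_surjective (σ := Fin n) (R := ℝ) (n := n) (by simp) ⟨f, hf⟩
  have hgf : aeval (fun i : Fin n ↦ esymm (Fin n) ℝ (i + 1)) g = f := by
    rw [← esymmAlgHom_apply, hg]
  have heval (u : Fin n → ℝ) :
      eval u f = eval (fun i : Fin n ↦ eval u (esymm (Fin n) ℝ (i + 1))) g := by
    rw [← hgf]
    clear hg hgf
    induction g using MvPolynomial.induction_on with
    | C a => simp
    | add p q hp hq => simp only [map_add, hp, hq]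
    | mul_X p i hp => simp only [map_mul, hp, aeval_X, eval_X]
  set e : (Fin n → ℝ) → Fin n → ℝ := fun u i ↦ eval u (esymm (Fin n) ℝ (i + 1)) with he
  have hy : e y = e x + (e y - e x) := by abel
  have hz : e z = e x - (e y - e x) := by
    ext i
    have := hmid (i + 1) i.2
    simp only [he, Pi.sub_apply]
    linarith
  rw [heval, heval, heval]
  change eval (e y) g + eval (e z) g = 2 * eval (e x) g
  rw [hz]
  nth_rw 1 [hy]
  refine eval_add_add_eval_sub g (k := k) (fun t ht ↦ ?_) _ _ fun i hi ↦ ?_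
  · have := weight_le_of_mem_support g ht
    rw [hgf] at this
    omega
  · simp [he, hlow (i + 1) hi]

/-! ### Perturbing simple real roots -/

open Filter Topology in
open Polynomial in
/-- A monic real polynomial with simple real roots in an open set keeps this property, and its
degree, under small perturbations of lower degree. -/
lemma eventually_prod_X_sub_C_add_eq_prod (T : Finset ℝ) {U : Set ℝ} (hU : IsOpen U)
    (hTU : (T : Set ℝ) ⊆ U) (q : ℝ[X]) (hq : q.degree < T.card) :
    ∀ᶠ ε in 𝓝 (0 : ℝ), ∃ T' : Finset ℝ, (T' : Set ℝ) ⊆ U ∧ T'.card = T.card ∧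
      ∏ t ∈ T, (X - C t) + C ε * q = ∏ t ∈ T', (X - C t) := by
  have hδ : ∃ δ > 0, (∀ t ∈ T, Metric.ball t δ ⊆ U) ∧
      ∀ t ∈ T, ∀ s ∈ T, t ≠ s → 2 * δ < |t - s| := by
    have hlt (r : ℝ) (hr : 0 < r) : ∀ᶠ δ in 𝓝[>] (0 : ℝ), 2 * δ < r := by
      filter_upwards [Ioo_mem_nhdsGT (half_pos hr)] with δ hδ
      linarith [hδ.2]
    have h1 : ∀ᶠ δ in 𝓝[>] (0 : ℝ), ∀ t ∈ T, Metric.ball t δ ⊆ U := by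
      rw [Filter.eventually_all_finset]
      intro t ht
      obtain ⟨r, hr, hball⟩ := Metric.isOpen_iff.mp hU t (hTU ht)
      filter_upwards [Ioo_mem_nhdsGT hr] with δ hδ
      exact (Metric.ball_subset_ball hδ.2.le).trans hball
    have h2 : ∀ᶠ δ in 𝓝[>] (0 : ℝ), ∀ t ∈ T, ∀ s ∈ T, t ≠ s → 2 * δ < |t - s| := by
      rw [Filter.eventually_all_finset]
      intro t _
      rw [Filter.eventually_all_finset]
      intro s _
      rw [Filter.eventually_imp_distrib_left]
      exact fun hts ↦ hlt _ (abs_pos.mpr (sub_ne_zero.mpr hts))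
    obtain ⟨δ, ⟨h1, h2⟩, h0⟩ := ((h1.and h2).and self_mem_nhdsWithin).exists
    exact ⟨δ, h0, h1, h2⟩
  obtain ⟨δ, hδ0, hδU, hδT⟩ := hδ
  set Q : ℝ[X] := ∏ t ∈ T, (X - C t) with hQ
  have hQmonic : Q.Monic := monic_prod_of_monic _ _ fun t _ ↦ monic_X_sub_C t
  have hQdeg : Q.natDegree = T.card := by simp [hQ]
  -- All factors of `Q` other than `X - t` have the same sign at `t - δ` and `t + δ`.
  have hsign : ∀ t ∈ T, Q.eval (t - δ) * Q.eval (t + δ) < 0 := by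
    intro t ht
    rw [hQ, eval_prod, eval_prod, ← Finset.mul_prod_erase _ _ ht, ← Finset.mul_prod_erase _ _ ht,
      mul_mul_mul_comm, ← Finset.prod_mul_distrib]
    refine mul_neg_of_neg_of_pos ?_ (Finset.prod_pos fun s hs ↦ ?_)
    · simp only [eval_sub, eval_X, eval_C]
      nlinarith
    · obtain ⟨hne, hs⟩ := Finset.mem_erase.mp hs
      have h1 := hδT t ht s hs hne.symm
      have h2 := sq_abs (t - s)
      simp only [eval_sub, eval_X, eval_C]
      nlinarith
  have hev : ∀ᶠ ε in 𝓝 (0 : ℝ), ∀ t ∈ T,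
      (Q + C ε * q).eval (t - δ) * (Q + C ε * q).eval (t + δ) < 0 := by
    rw [Filter.eventually_all_finset]
    intro t ht
    have hc : Continuous fun ε : ℝ ↦
        (Q + C ε * q).eval (t - δ) * (Q + C ε * q).eval (t + δ) := by
      simp only [eval_add, eval_mul, eval_C]
      fun_prop
    exact hc.tendsto 0 |>.eventually_lt_const (by simpa using hsign t ht)
  filter_upwards [hev] with ε hε
  set F : ℝ[X] := Q + C ε * q with hF
  have hdeg : (C ε * q).degree < Q.degree := by
    rw [degree_eq_natDegree hQmonic.ne_zero, hQdeg]
    rw [← smul_eq_C_mul]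
    exact (degree_smul_le _ _).trans_lt hq
  have hFmonic : F.Monic := hQmonic.add_of_left hdeg
  have hFdeg : F.natDegree = T.card := by rw [hF, natDegree_add_eq_left_of_degree_lt hdeg, hQdeg]
  have hroot : ∀ t ∈ T, ∃ r ∈ Set.Ioo (t - δ) (t + δ), F.eval r = 0 := by
    intro t ht
    have hc : ContinuousOn (fun s ↦ F.eval s) (Set.Icc (t - δ) (t + δ)) := F.continuousOn
    rcases mul_neg_iff.mp (hε t ht) with h | h
    · exact intermediate_value_Ioo' (by linarith) hc ⟨h.2, h.1⟩
    · exact intermediate_value_Ioo (by linarith) hc ⟨h.1, h.2⟩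
  choose! r hrmem hr using hroot
  have hinj : Set.InjOn r T := by
    intro t ht s hs hts
    by_contra hne
    have h1 := hrmem t ht
    have h2 := hrmem s hs
    rw [hts] at h1
    have : |t - s| < 2 * δ := abs_lt.mpr ⟨by linarith [h1.2, h2.1], by linarith [h1.1, h2.2]⟩
    linarith [hδT t ht s hs hne]
  have hcard : (T.image r).card = T.card := Finset.card_image_of_injOn hinj
  refine ⟨T.image r, ?_, hcard, ?_⟩
  · intro s hs
    obtain ⟨t, ht, rfl⟩ := Finset.mem_image.mp (Finset.mem_coe.mp hs)
    refine hδU t ht ?_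
    rw [Real.ball_eq_Ioo]
    exact hrmem t ht
  · have hle : (T.image r).val ≤ F.roots := by
      rw [Multiset.le_iff_subset (T.image r).nodup]
      intro s hs
      obtain ⟨t, ht, rfl⟩ := Finset.mem_image.mp (Finset.mem_val.mp hs)
      exact (mem_roots hFmonic.ne_zero).mpr (hr t ht)
    have heq : (T.image r).val = F.roots := by
      refine Multiset.eq_of_le_of_card_le hle ?_
      rw [Finset.card_val, hcard, ← hFdeg]
      exact card_roots' F
    have := prod_multiset_X_sub_C_of_monic_of_roots_card_eq hFmonic
      (by rw [← heq, Finset.card_val, hcard, hFdeg])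
    rw [← this, ← heq]
    rfl

lemma exists_univ_val_map_eq {n : ℕ} (s : Multiset ℝ) (hs : s.card = n) :
    ∃ x : Fin n → ℝ, Finset.univ.val.map x = s := by
  obtain ⟨l, rfl⟩ : ∃ l : List ℝ, (l : Multiset ℝ) = s := ⟨s.toList, s.coe_toList⟩
  obtain rfl : l.length = n := by simpa using hs
  exact ⟨l.get, by rw [Fin.univ_val_map, List.ofFn_get]⟩

open MvPolynomial in
lemma eval_esymm_eq_coeff {n j : ℕ} (x : Fin n → ℝ) (hj : j ≤ n) :
    eval x (esymm (Fin n) ℝ j) = (-1) ^ j *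
      (((Finset.univ.val.map x).map fun t ↦ Polynomial.X - Polynomial.C t).prod).coeff (n - j) := by
  have hcard : (Finset.univ.val.map x).card = n := by simp
  rw [Multiset.prod_X_sub_C_coeff _ (by omega), hcard, Nat.sub_sub_self hj, ← mul_assoc,
    ← mul_pow, ← aeval_esymm_eq_multiset_esymm (Fin n) ℝ, ← coe_aeval_eq_eval]
  simp

open MvPolynomial in
/-- A point with more than `k` distinct coordinates in an open set `U` is, in terms of the elementary
symmetric polynomials, the midpoint of a segment along which `e_1, …, e_k` are constant and
`e_{k+1}` is not. Only the coordinates in `U` are moved, and they stay in `U`. -/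
lemma exists_esymm_segment {n k : ℕ} (x : Fin n → ℝ) {U : Set ℝ} (hU : IsOpen U)
    (hk : k < (Set.range x ∩ U).ncard) :
    ∃ y z : Fin n → ℝ, (∀ i, y i ∈ U ∪ Set.range x) ∧ (∀ i, z i ∈ U ∪ Set.range x) ∧
      (∀ j ≤ k, eval y (esymm (Fin n) ℝ j) = eval x (esymm (Fin n) ℝ j)) ∧
      (∀ j ≤ n, eval y (esymm (Fin n) ℝ j) + eval z (esymm (Fin n) ℝ j) =
        2 * eval x (esymm (Fin n) ℝ j)) ∧
      eval y (esymm (Fin n) ℝ (k + 1)) < eval x (esymm (Fin n) ℝ (k + 1)) := by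
  classical
  set s : Multiset ℝ := Finset.univ.val.map x with hs
  set T : Finset ℝ := (Finset.univ.image x).filter (· ∈ U) with hT
  have hcoe : (T : Set ℝ) = Set.range x ∩ U := by ext; simp [hT]
  rw [← hcoe, Set.ncard_coe_finset] at hk
  have hTs : T.val ≤ s := by
    rw [Multiset.le_iff_subset T.nodup]
    intro t ht
    obtain ⟨ht, -⟩ := Finset.mem_filter.mp (Finset.mem_val.mp ht)
    obtain ⟨i, -, rfl⟩ := Finset.mem_image.mp ht
    exact Multiset.mem_map_of_mem x (Finset.mem_univ i)
  obtain ⟨s', hs'⟩ := Multiset.le_iff_exists_add.mp hTs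
  have hcard : T.card + s'.card = n := by
    have := congrArg Multiset.card hs'
    simpa [hs] using this.symm
  have hs'mem : ∀ t ∈ s', t ∈ Set.range x := by
    intro t ht
    have : t ∈ s := hs' ▸ Multiset.mem_add.mpr (Or.inr ht)
    obtain ⟨i, -, rfl⟩ := Multiset.mem_map.mp this
    exact ⟨i, rfl⟩
  set R : Polynomial ℝ := (s'.map fun t ↦ Polynomial.X - Polynomial.C t).prod with hR
  -- The power of `X` is chosen so that `h` has degree exactly `n - (k + 1)`.
  set h : Polynomial ℝ := Polynomial.X ^ (T.card - (k + 1)) * R with hh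
  have hRmonic : R.Monic := Polynomial.monic_multiset_prod_of_monic _ _
    fun t _ ↦ Polynomial.monic_X_sub_C t
  have hhmonic : h.Monic := (Polynomial.monic_X_pow _).mul hRmonic
  have hhdeg : h.natDegree = n - (k + 1) := by
    rw [hh, (Polynomial.monic_X_pow _).natDegree_mul hRmonic, Polynomial.natDegree_X_pow, hR,
      Polynomial.natDegree_multiset_prod_X_sub_C_eq_card]
    omega
  have hqdeg : (Polynomial.X ^ (T.card - (k + 1)) : Polynomial ℝ).degree < T.card := by
    rw [Polynomial.degree_X_pow]
    exact_mod_cast (by omega : T.card - (k + 1) < T.card)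
  have hTU : (T : Set ℝ) ⊆ U := hcoe ▸ Set.inter_subset_right
  obtain ⟨ρ, hρ, hball⟩ := Metric.eventually_nhds_iff.mp
    (eventually_prod_X_sub_C_add_eq_prod T hU hTU _ hqdeg)
  have hmove (η : ℝ) (hη : |η| < ρ) : ∃ y : Fin n → ℝ, (∀ i, y i ∈ U ∪ Set.range x) ∧
      ∀ j ≤ n, eval y (esymm (Fin n) ℝ j) =
        eval x (esymm (Fin n) ℝ j) + (-1) ^ j * (η * h.coeff (n - j)) := by
    obtain ⟨T', hT'U, hT'card, hT'⟩ := hball (y := η) (by simpa using hη)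
    obtain ⟨y, hy⟩ := exists_univ_val_map_eq (n := n) (T'.val + s') (by simp [hT'card, hcard])
    refine ⟨y, fun i ↦ ?_, fun j hj ↦ ?_⟩
    · have hyi : y i ∈ T'.val + s' := hy ▸ Multiset.mem_map_of_mem y (Finset.mem_univ i)
      rcases Multiset.mem_add.mp hyi with hyi | hyi
      · exact Or.inl (hT'U hyi)
      · exact Or.inr (hs'mem _ hyi)
    · have hpoly : ((Finset.univ.val.map y).map fun t ↦ Polynomial.X - Polynomial.C t).prod =
          (s.map fun t ↦ Polynomial.X - Polynomial.C t).prod + Polynomial.C η * h := by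
        rw [hy, hs', Multiset.map_add, Multiset.map_add, Multiset.prod_add, Multiset.prod_add]
        change (∏ t ∈ T', (Polynomial.X - Polynomial.C t)) * R =
          (∏ t ∈ T, (Polynomial.X - Polynomial.C t)) * R + _
        rw [← hT', hh]
        ring
      rw [eval_esymm_eq_coeff y hj, eval_esymm_eq_coeff x hj, hpoly, Polynomial.coeff_add,
        Polynomial.coeff_C_mul]
      ring
  -- The sign `(-1) ^ k` makes `e_{k+1}` decrease from `x` to `y`.
  have hsign : |(-1 : ℝ) ^ k * (ρ / 2)| < ρ := by
    rw [abs_mul, abs_pow, abs_neg, abs_one, one_pow, one_mul, abs_of_pos (by linarith)]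
    linarith
  obtain ⟨y, hyU, hy⟩ := hmove ((-1) ^ k * (ρ / 2)) hsign
  obtain ⟨z, hzU, hz⟩ := hmove (-((-1) ^ k * (ρ / 2))) (by rwa [abs_neg])
  have hkn : k + 1 ≤ n := by omega
  refine ⟨y, z, hyU, hzU, fun j hj ↦ ?_, fun j hj ↦ ?_, ?_⟩
  · rw [hy j (by omega), Polynomial.coeff_eq_zero_of_natDegree_lt (by omega)]
    simp
  · rw [hy j hj, hz j hj]
    ring
  · have hlead : h.coeff (n - (k + 1)) = 1 := by rw [← hhdeg]; exact hhmonic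
    have hpow : (-1 : ℝ) ^ (k + 1) * ((-1) ^ k * (ρ / 2)) = -(ρ / 2) := by
      rw [← mul_assoc, ← pow_add, (by ring : k + 1 + k = 2 * k + 1), pow_succ, pow_mul]
      simp
    rw [hy (k + 1) hkn, hlead, mul_one, hpow]
    linarith

/-! ### Minimising on fibres of the first elementary symmetric polynomials -/

open MvPolynomial in
/-- The points with all coordinates in `D` at which `e_0, …, e_k` take the same values as at `y`. -/
def esymmFibre {n : ℕ} (D : Set ℝ) (k : ℕ) (y : Fin n → ℝ) : Set (Fin n → ℝ) :=
  {x | (∀ i, x i ∈ D) ∧ ∀ j ≤ k, eval x (esymm (Fin n) ℝ j) = eval y (esymm (Fin n) ℝ j)}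

lemma isClosed_esymmFibre {n k : ℕ} {D : Set ℝ} (hD : IsClosed D) (y : Fin n → ℝ) :
    IsClosed (esymmFibre D k y) := by
  simp only [esymmFibre, Set.ofPred_and, Set.ofPred_forall]
  refine IsClosed.inter (isClosed_iInter fun i ↦ hD.preimage (continuous_apply i))
    (isClosed_iInter fun j ↦ isClosed_iInter fun _ ↦ ?_)
  exact isClosed_eq (MvPolynomial.continuous_eval _) continuous_const

open MvPolynomial in
/-- Newton's identity for the sum of squares, evaluated at a point. -/
lemma sum_sq_eq {n : ℕ} (x : Fin n → ℝ) :
    ∑ i, x i ^ 2 = eval x (esymm (Fin n) ℝ 1) ^ 2 - 2 * eval x (esymm (Fin n) ℝ 2) := by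
  have h := congrArg (eval x) (psum_eq_mul_esymm_sub_sum (Fin n) ℝ 2 two_pos)
  have h1 : (Finset.HasAntidiagonal.antidiagonal 2).filter
      (fun a : ℕ × ℕ ↦ a.1 ∈ Set.Ioo 0 2) = {(1, 1)} := by
    ext ⟨a, b⟩
    simp only [Finset.mem_filter, Finset.HasAntidiagonal.mem_antidiagonal, Set.mem_Ioo,
      Finset.mem_singleton, Prod.mk.injEq]
    omega
  rw [h1] at h
  simp [psum, esymm_one] at h ⊢
  linarith

lemma isCompact_esymmFibre_univ {n k : ℕ} (hk : 2 ≤ k) (y : Fin n → ℝ) :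
    IsCompact (esymmFibre Set.univ k y) := by
  refine Metric.isCompact_of_isClosed_isBounded (isClosed_esymmFibre isClosed_univ y) ?_
  refine isBounded_iff_forall_norm_le.mpr ⟨∑ i, y i ^ 2 + 1, fun x hx ↦ ?_⟩
  have hnonneg : 0 ≤ ∑ i, y i ^ 2 := Finset.sum_nonneg fun i _ ↦ sq_nonneg _
  refine (pi_norm_le_iff_of_nonneg (by linarith)).mpr fun i ↦ ?_
  have hi := Finset.single_le_sum (f := fun i ↦ x i ^ 2) (fun i _ ↦ sq_nonneg _)
    (Finset.mem_univ i)
  have heq : ∑ i, x i ^ 2 = ∑ i, y i ^ 2 := by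
    rw [sum_sq_eq, sum_sq_eq, hx.2 1 (by omega), hx.2 2 hk]
  rw [Real.norm_eq_abs]
  simp only [heq, ← sq_abs (x i)] at hi
  nlinarith [sq_nonneg (|x i| - 1)]

lemma isCompact_esymmFibre_Ici {n k : ℕ} (hk : 1 ≤ k) (y : Fin n → ℝ) :
    IsCompact (esymmFibre (Set.Ici 0) k y) := by
  refine Metric.isCompact_of_isClosed_isBounded (isClosed_esymmFibre isClosed_Ici y) ?_
  refine isBounded_iff_forall_norm_le.mpr ⟨|∑ i, y i|, fun x hx ↦ ?_⟩
  refine (pi_norm_le_iff_of_nonneg (abs_nonneg _)).mpr fun i ↦ ?_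
  have hi := Finset.single_le_sum (f := x) (fun i _ ↦ hx.1 i) (Finset.mem_univ i)
  have heq : ∑ i, x i = ∑ i, y i := by simpa [MvPolynomial.esymm_one] using hx.2 1 hk
  rw [Real.norm_eq_abs, abs_of_nonneg (hx.1 i)]
  exact hi.trans (heq ▸ le_abs_self _)

open MvPolynomial in
/-- The common core of the three statements: within a compact fibre of `e_1, …, e_k`, the value of a
symmetric polynomial of degree less than `2 (k + 1)` is not increased by passing to a suitable point
with at most `k` distinct coordinates in `U`. -/
theorem exists_eval_le_ncard_le {n k : ℕ} {f : MvPolynomial (Fin n) ℝ} (hf : f.IsSymmetric)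
    (hk : f.totalDegree < 2 * (k + 1)) {U D : Set ℝ} (hU : IsOpen U) (hUD : U ⊆ D)
    {y : Fin n → ℝ} (hy : ∀ i, y i ∈ D) (hK : IsCompact (esymmFibre D k y)) :
    ∃ x : Fin n → ℝ, (∀ i, x i ∈ D) ∧ (Set.range x ∩ U).ncard ≤ k ∧ eval x f ≤ eval y f := by
  set K := esymmFibre D k y
  have hyK : y ∈ K := ⟨hy, fun _ _ ↦ rfl⟩
  obtain ⟨x₀, hx₀, hmin⟩ := hK.exists_isMinOn ⟨y, hyK⟩ (continuous_eval f).continuousOn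
  have hM : IsCompact (K ∩ {x | eval x f = eval x₀ f}) :=
    hK.inter_right (isClosed_eq (continuous_eval f) continuous_const)
  -- Breaking ties between minimisers by `e_{k+1}` excludes segments on which `f` is constant.
  obtain ⟨x, ⟨hxK, hxf⟩, hxmin⟩ := hM.exists_isMinOn ⟨x₀, hx₀, rfl⟩
    (continuous_eval (esymm (Fin n) ℝ (k + 1))).continuousOn
  refine ⟨x, hxK.1, ?_, hxf.trans_le (hmin hyK)⟩
  by_contra! hlt
  obtain ⟨u, v, hu, hv, hulow, huv, hulast⟩ := exists_esymm_segment x hU hlt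
  have hle : k ≤ n := by
    have h1 := Set.ncard_le_ncard (Set.inter_subset_left (s := Set.range x) (t := U))
      (Set.finite_range x)
    have h2 : (Set.range x).ncard ≤ n := by
      rw [← Set.image_univ]
      simpa using Set.ncard_image_le (f := x) Set.finite_univ
    omega
  have hD (w : Fin n → ℝ) (hw : ∀ i, w i ∈ U ∪ Set.range x) (i : Fin n) : w i ∈ D := by
    rcases hw i with h | ⟨l, h⟩
    · exact hUD h
    · exact h ▸ hxK.1 l
  have huK : u ∈ K := ⟨hD u hu, fun j hj ↦ (hulow j hj).trans (hxK.2 j hj)⟩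
  have hvK : v ∈ K := ⟨hD v hv, fun j hj ↦ by
    have h1 := huv j (hj.trans hle)
    have h2 := hulow j hj
    rw [← hxK.2 j hj]
    linarith⟩
  have hsum := eval_add_eval_of_isSymmetric hf hk hulow huv
  have huf : eval x₀ f ≤ eval u f := hmin huK
  have hvf : eval x₀ f ≤ eval v f := hmin hvK
  have hxf' : eval x f = eval x₀ f := hxf
  have huM : u ∈ K ∩ {x | eval x f = eval x₀ f} :=
    ⟨huK, show eval u f = eval x₀ f by linarith⟩
  exact absurd (hxmin huM) (not_le.mpr hulast)
end HalfDegree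

theorem theorem3p1 (n d : ℕ) (f : MvPolynomial (Fin n) ℝ) (hsymm : f.IsSymmetric)
    (hdeg : f.totalDegree = d) :
    ((HalfDegree.A n (max 2 (d / 2))).Nonempty ∧
      ((∀ y : Fin n → ℝ, 0 ≤ MvPolynomial.eval y f) ↔
        ∀ y ∈ HalfDegree.A n (max 2 (d / 2)), 0 ≤ MvPolynomial.eval y f)) ∧
    ((HalfDegree.APos n (max 1 (d / 2))).Nonempty ∧
      ((∀ y : Fin n → ℝ, (∀ i, 0 ≤ y i) → 0 ≤ MvPolynomial.eval y f) ↔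
        ∀ y ∈ HalfDegree.APos n (max 1 (d / 2)), 0 ≤ MvPolynomial.eval y f)) ∧
    ((HalfDegree.zeroSet f).Nonempty ↔
      (HalfDegree.zeroSet f ∩ HalfDegree.A n (max 2 d)).Nonempty) := by
  have hA (x : Fin n → ℝ) (k : ℕ) (hx : (Set.range x ∩ Set.univ).ncard ≤ k) :
      x ∈ HalfDegree.A n k := by rwa [Set.inter_univ] at hx
  have hrange : (Set.range (0 : Fin n → ℝ)).ncard ≤ 1 :=
    (Set.ncard_le_ncard (t := {0}) (by rintro _ ⟨i, rfl⟩; rfl)).trans (Set.ncard_singleton _).le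
  refine ⟨⟨⟨0, hrange.trans (by omega)⟩, fun h y _ ↦ h y, fun h y ↦ ?_⟩,
    ⟨⟨0, fun _ ↦ le_rfl, ?_⟩, fun h y hy ↦ h y hy.1, fun h y hy ↦ ?_⟩, ?_⟩
  · obtain ⟨x, -, hx, hxy⟩ := HalfDegree.exists_eval_le_ncard_le hsymm
      (k := max 2 (d / 2)) (by omega) isOpen_univ Set.Subset.rfl (fun _ ↦ Set.mem_univ _)
      (HalfDegree.isCompact_esymmFibre_univ (le_max_left _ _) y)
    exact (h x (hA x _ hx)).trans hxy
  · exact ((Set.ncard_le_ncard Set.inter_subset_left (Set.finite_range _)).trans hrange).trans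
      (le_max_left _ _)
  · obtain ⟨x, hx0, hx, hxy⟩ := HalfDegree.exists_eval_le_ncard_le hsymm
      (k := max 1 (d / 2)) (by omega) isOpen_Ioi Set.Ioi_subset_Ici_self hy
      (HalfDegree.isCompact_esymmFibre_Ici (le_max_left _ _) y)
    exact (h x ⟨hx0, hx⟩).trans hxy
  · refine ⟨fun ⟨y, hy⟩ ↦ ?_, fun ⟨x, hx, _⟩ ↦ ⟨x, hx⟩⟩
    -- A zero of `f` minimises `f ^ 2`, so any point with a value of `f ^ 2` at most `0` is a zero.
    have hpow : (f ^ 2).totalDegree ≤ 2 * f.totalDegree := MvPolynomial.totalDegree_pow f 2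
    have hsymm2 : (f ^ 2).IsSymmetric := fun e ↦ by rw [map_pow, hsymm e]
    obtain ⟨x, -, hx, hxy⟩ := HalfDegree.exists_eval_le_ncard_le hsymm2
      (k := max 2 d) (by omega) isOpen_univ Set.Subset.rfl (fun _ ↦ Set.mem_univ _)
      (HalfDegree.isCompact_esymmFibre_univ (le_max_left _ _) y)
    have hy0 : MvPolynomial.eval y f = 0 := hy
    rw [map_pow, map_pow, hy0] at hxy
    have hx0 : MvPolynomial.eval x f = 0 := by nlinarith [sq_nonneg (MvPolynomial.eval x f)]
    exact ⟨x, hx0, hA x _ hx⟩
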